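/- **Theorem 3.2 (Converse Functional Calculus).** Let $A$ be a graded $C^*$-algebra (a complex $C^*$-algebra with a $*$-automorphism $\alpha$, $\alpha^2=\mathrm{id}$, and $A_n=\{a:\alpha(a)=(-1)^na\}$) and let $\mathcal H$ be a graded Hilbert $A$-module, that is, a Hilbert $A$-module with closed linear subspaces such that $\mathcal H=\mathcal H_0\oplus\mathcal H_1$, $\mathcal H_nA_m\subseteq\mathcal H_{n+m}$ and $\langle\mathcal H_n,\mathcal H_m\rangle\subseteq A_{n+m}$ (indices mod $2$). Let $\mathcal L(\mathcal H)$ be the $C^*$-algebra of adjointable operators, where $T$ has degree $m$ if $T\mathcal H_n\subseteq\mathcal H_{n+m}$ for $n=0,1$, and let $\mathcal K(\mathcal H)$ be the closed linear span of the operators $z\mapsto x\langle y,z\rangle$. Grade $C_0(\mathbb R)=C_0(\mathbb R,\mathbb C)$ by even and odd functions, and let $\varphi:C_0(\mathbb R)\to\mathcal L(\mathcal H)$ be a $*$-homomorphism that preserves degrees. Let $\mathcal H_\varphi$ be the closed linear span of $\varphi(C_0(\mathbb R))\mathcal H$. Then $\mathcal H_\varphi$ is a closed $\varphi$-invariant $A$-submodule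 of $\mathcal H$ which is graded, i.e. $\mathcal H_\varphi=(\mathcal H_\varphi\cap\mathcal H_0)\oplus(\mathcal H_\varphi\cap\mathcal H_1)$, and there is a self-adjoint regular operator $D$ on $\mathcal H_\varphi$ of degree one such that $$\varphi(f)x=f(D)x\qquad\text{for all } f\in C_0(\mathbb R),\ x\in\mathcal H_\varphi .$$ Moreover, this $D$ satisfies the following. 1. If $\varphi$ is strict, i.e. $(\varphi(u_i))$ is Cauchy in the strict topology of $\mathcal L(\mathcal H)$ for some approximate unit $(u_i)$ of $C_0(\mathbb R)$, then $\mathcal H_\varphi$ is complemented, $\mathcal H=\mathcal H_\varphi\oplus\mathcal H_\varphi^\perp$, and $\varphi(f)=f(D)$ for all $f\in C_0(\mathbb R)$ under the inclusion $\mathcal L(\mathcal H_\varphi)\subseteq\mathcal L(\mathcal H)$ that extends operators by $0$ on $\mathcal H_\varphi^\perp$. 2. If $\varphi$ is nondegenerate, i.e. the linear span of $\varphi(C_0(\mathbb R))\mathcal H$ is dense in $\mathcal H$, then $\mathcal H_\varphi=\mathcal H$. 3. If $\varphi(C_0(\mathbb R))\subseteq\mathcal K(\mathcal H)$, then $D$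 has compact resolvents: for every $z\in\mathbb C\setminus\mathbb R$ the inverse $(D-z)^{-1}$ exists and lies in $\mathcal K(\mathcal H_\varphi)$. Here a regular operator on a Hilbert $A$-module is a densely defined closed $A$-linear operator $D$ whose adjoint $D^*$ is densely defined and for which $1+D^*D$ has dense range; it is self-adjoint if $D=D^*$; it has degree one if its domain is graded and $D$ maps homogeneous elements of degree $n$ to elements of degree $n+1$. The strict topology on $\mathcal L(\mathcal H)$ is given by the seminorms $T\mapsto\|Tx\|$ and $T\mapsto\|T^*x\|$, $x\in\mathcal H$. For self-adjoint regular $D$, $f(D)$ denotes the functional calculus: $f(D)=\tilde f(U)$, where $U=(D-i)(D+i)^{-1}$ is the unitary Cayley transform of $D$ and $\tilde f$ is the continuous function on the unit circle with $\tilde f\big(\tfrac{t-i}{t+i}\big)=f(t)$ for $t\in\mathbb R$ and $\tilde f(1)=0$. -/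

import Mathlib

open scoped ZeroAtInfty

noncomputable section

namespace HilbertMod

/-! ### Graded C⋆-algebras -/

/-- A grading on a C⋆-algebra `A`: a `*`-automorphism whose square is the identity. -/
structure CStarGrading (A : Type*) [NonUnitalCStarAlgebra A] where
  /-- the grading automorphism -/
  aut : A ≃⋆ₐ[ℂ] A
  aut_aut : ∀ a, aut (aut a) = a

/-- The homogeneous part `A_n = {a | α(a) = (-1)ⁿ a}`, `n ∈ ℤ/2`. -/
def CStarGrading.part {A : Type*} [NonUnitalCStarAlgebra A] (α : CStarGrading A) (n : ZMod 2) :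
    Submodule ℂ A where
  carrier := {a | α.aut a = (-1 : ℂ) ^ n.val • a}
  add_mem' {a b} ha hb := by
    simp only [Set.mem_ofPred_eq] at *
    rw [map_add, ha, hb, smul_add]
  zero_mem' := by simp
  smul_mem' c a ha := by
    simp only [Set.mem_ofPred_eq] at *
    rw [map_smul, ha, smul_comm]

/-- The even-odd function grading of `C₀(ℝ)`: `α(f)(t) = f(-t)`. -/
def evenOddGrading : CStarGrading C₀(ℝ, ℂ) where
  aut :=
    { toFun := fun f => f.comp (Homeomorph.neg ℝ).toCocompactMap
      invFun := fun f => f.comp (Homeomorph.neg ℝ).toCocompactMap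
      left_inv := fun f => by ext t; simp
      right_inv := fun f => by ext t; simp
      map_mul' := fun f g => by ext t; simp
      map_add' := fun f g => by ext t; simp
      map_star' := fun f => by ext t; simp
      map_smul' := fun c f => by ext t; simp }
  aut_aut := fun f => by
    ext t
    change f (- -t) = f t
    rw [neg_neg]

/-! ### Adjointable operators on a Hilbert module

A Hilbert `A`-module is a complete `CStarModule A E`. Mathlib writes the module action on the
left, with `⟨x, a y⟩ = a ⟨x, y⟩`; right Hilbert modules over a C⋆-algebra `B` are covered by taking
`A = Bᵐᵒᵖ`. -/

variable (A E : Type*) [NonUnitalCStarAlgebra A] [PartialOrder A] [StarOrderedRing A]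
  [NormedAddCommGroup E] [NormedSpace ℂ E] [SMul A E] [CStarModule A E]

section basics

variable {A E}

theorem ext_inner {x y : E} (h : ∀ z : E, inner A z x = inner A z y) : x = y := by
  have h1 : inner A (x - y) (x - y) = 0 := by
    rw [CStarModule.inner_sub_right, h, sub_self]
  exact sub_eq_zero.mp (CStarModule.inner_self.mp h1)

theorem add_smul_alg (a b : A) (x : E) : (a + b) • x = a • x + b • x :=
  ext_inner (A := A) fun z => by simp [add_mul]

theorem smul_add_alg (a : A) (x y : E) : a • (x + y) = a • x + a • y :=
  ext_inner (A := A) fun z => by simp [mul_add]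

theorem smul_smul_alg (c : ℂ) (a : A) (x : E) : (c • a) • x = c • a • x :=
  ext_inner (A := A) fun z => by simp [smul_mul_assoc]

theorem le_of_sq_le_sq' {a b : ℝ} (h : a ^ 2 ≤ b ^ 2) (hb : 0 ≤ b) : a ≤ b :=
  (abs_le_of_sq_le_sq' h hb).2

theorem norm_smul_alg_le (a : A) (x : E) : ‖a • x‖ ≤ ‖a‖ * ‖x‖ := by
  have h : ‖a • x‖ ^ 2 ≤ (‖a‖ * ‖x‖) ^ 2 := by
    rw [CStarModule.norm_sq_eq A, CStarModule.inner_op_smul_right,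
      CStarModule.inner_op_smul_left, mul_pow, CStarModule.norm_sq_eq A (x := x)]
    calc ‖a * (inner A x x * star a)‖ ≤ ‖a‖ * (‖(inner A x x : A)‖ * ‖star a‖) :=
          (norm_mul_le _ _).trans (by gcongr; exact norm_mul_le _ _)
      _ = ‖a‖ ^ 2 * ‖(inner A x x : A)‖ := by rw [norm_star]; ring
  exact le_of_sq_le_sq' h (by positivity)

theorem norm_le_of_inner {x : E} {c : ℝ} (hc : 0 ≤ c)
    (h : ‖(inner A x x : A)‖ ≤ c * ‖x‖) : ‖x‖ ≤ c := by
  rw [← CStarModule.norm_sq_eq A, sq] at h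
  rcases (norm_nonneg x).eq_or_lt with h0 | h0
  · rw [← h0]; exact hc
  · exact le_of_mul_le_mul_right h h0

end basics

/-- The algebra of bounded `A`-linear maps on `E` possessing an adjoint. -/
def adjointable : Subalgebra ℂ (E →L[ℂ] E) where
  carrier := {T | (∀ (a : A) (x : E), T (a • x) = a • T x) ∧
    ∃ S : E →L[ℂ] E, ∀ x y, inner A (T x) y = inner A x (S y)}
  mul_mem' := by
    rintro T T' ⟨hT, S, hS⟩ ⟨hT', S', hS'⟩
    refine ⟨fun a x => ?_, S' * S, fun x y => ?_⟩
    · simp only [mul_apply_eq_comp, hT', hT]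
    · simp only [mul_apply_eq_comp, hS, hS']
  add_mem' := by
    rintro T T' ⟨hT, S, hS⟩ ⟨hT', S', hS'⟩
    refine ⟨fun a x => ?_, S + S', fun x y => ?_⟩
    · simp only [add_apply, hT', hT, smul_add_alg]
    · simp only [add_apply, CStarModule.inner_add_left,
        CStarModule.inner_add_right, hS, hS']
  algebraMap_mem' c := by
    refine ⟨fun a x => ?_, algebraMap ℂ _ (star c), fun x y => ?_⟩
    · refine ext_inner (A := A) fun z => ?_
      simp [Algebra.algebraMap_eq_smul_one, mul_smul_comm]
    · simp [Algebra.algebraMap_eq_smul_one]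

/-- `𝓛(E)`, the C⋆-algebra of adjointable operators on `E`, with the operator norm. -/
abbrev Adj : Type _ := adjointable A E

variable {A E}

namespace Adj

theorem exists_adjoint (T : Adj A E) :
    ∃ S : Adj A E, ∀ x y, inner A (T.1 x) y = inner A x (S.1 y) := by
  obtain ⟨hT, S, hS⟩ := T.2
  refine ⟨⟨S, fun a x => ext_inner (A := A) fun z => ?_, T.1, fun x y => ?_⟩, hS⟩
  · rw [← hS, CStarModule.inner_op_smul_right, CStarModule.inner_op_smul_right, hS]
  · rw [← CStarModule.star_inner, ← hS, CStarModule.star_inner]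

/-- The involution on `𝓛(E)` is the adjoint. -/
instance : Star (Adj A E) := ⟨fun T => T.exists_adjoint.choose⟩

theorem inner_left (T : Adj A E) (x y : E) : inner A (T.1 x) y = inner A x ((star T).1 y) :=
  T.exists_adjoint.choose_spec x y

theorem inner_right (T : Adj A E) (x y : E) : inner A x (T.1 y) = inner A ((star T).1 x) y := by
  rw [← CStarModule.star_inner, inner_left, CStarModule.star_inner]

theorem star_unique (T S : Adj A E) (h : ∀ x y, inner A (T.1 x) y = inner A x (S.1 y)) :
    star T = S :=
  Subtype.ext <| ContinuousLinearMap.ext fun y => ext_inner (A := A) fun x => by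
    rw [← inner_left, h]

instance : StarRing (Adj A E) where
  star_involutive T := star_unique _ _ fun x y => by rw [← inner_right]
  star_mul T S := star_unique _ _ fun x y => by
    change inner A (T.1 (S.1 x)) y = inner A x ((star S).1 ((star T).1 y))
    rw [inner_left, inner_left]
  star_add T S := star_unique _ _ fun x y => by
    change inner A (T.1 x + S.1 x) y = inner A x ((star T).1 y + (star S).1 y)
    rw [CStarModule.inner_add_left, CStarModule.inner_add_right, inner_left, inner_left]

instance : StarModule ℂ (Adj A E) where
  star_smul c T := star_unique _ _ fun x y => by
    change inner A (c • T.1 x) y = inner A x (star c • (star T).1 y)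
    rw [CStarModule.inner_smul_left_complex, CStarModule.inner_smul_right_complex, inner_left]

theorem norm_star_mul_ge (T : Adj A E) : ‖T‖ * ‖T‖ ≤ ‖star T * T‖ := by
  have h : ‖T‖ ≤ √‖star T * T‖ := by
    refine ContinuousLinearMap.opNorm_le_bound _ (Real.sqrt_nonneg _) fun x => ?_
    refine le_of_sq_le_sq' ?_ (by positivity)
    change ‖T.1 x‖ ^ 2 ≤ _
    rw [mul_pow, Real.sq_sqrt (norm_nonneg (star T * T)), CStarModule.norm_sq_eq A]
    have h1 : inner A (T.1 x) (T.1 x) = (inner A x ((star T * T).1 x) : A) := inner_left _ _ _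
    rw [h1]
    calc ‖(inner A x ((star T * T).1 x) : A)‖ ≤ ‖x‖ * ‖(star T * T).1 x‖ :=
          CStarModule.norm_inner_le E
      _ ≤ ‖x‖ * (‖star T * T‖ * ‖x‖) := by
          gcongr
          exact (star T * T).1.le_opNorm x
      _ = _ := by ring
  calc ‖T‖ * ‖T‖ ≤ √‖star T * T‖ * √‖star T * T‖ := by gcongr
    _ = _ := Real.mul_self_sqrt (norm_nonneg _)

instance : CStarRing (Adj A E) := ⟨norm_star_mul_ge⟩

instance [CompleteSpace E] : CompleteSpace (Adj A E) := by
  refine Metric.complete_of_cauchySeq_tendsto fun u hu => ?_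
  have hu1 : CauchySeq fun n => (u n).1 :=
    uniformContinuous_subtype_val.comp_cauchySeq hu
  have hu2 : CauchySeq fun n => (star (u n)).1 :=
    (uniformContinuous_subtype_val.comp
      (starₗᵢ ℂ : Adj A E ≃ₗᵢ⋆[ℂ] Adj A E).isometry.uniformContinuous).comp_cauchySeq hu
  obtain ⟨T, hT⟩ := cauchySeq_tendsto_of_complete hu1
  obtain ⟨S, hS⟩ := cauchySeq_tendsto_of_complete hu2
  have hTx : ∀ x, Filter.Tendsto (fun n => (u n).1 x) Filter.atTop (nhds (T x)) := fun x =>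
    ((ContinuousLinearMap.apply ℂ E x).continuous.tendsto T).comp hT
  have hSx : ∀ x, Filter.Tendsto (fun n => (star (u n)).1 x) Filter.atTop (nhds (S x)) :=
    fun x => ((ContinuousLinearMap.apply ℂ E x).continuous.tendsto S).comp hS
  have hadj : ∀ x y, inner A (T x) y = inner A x (S y) := fun x y => by
    have h1 : Filter.Tendsto (fun n => inner A ((u n).1 x) y) Filter.atTop
        (nhds (inner A (T x) y)) :=
      ((CStarModule.continuous_inner (A := A) (E := E)).tendsto (T x, y)).comp
        ((hTx x).prodMk_nhds tendsto_const_nhds)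
    have h2 : Filter.Tendsto (fun n => inner A x ((star (u n)).1 y)) Filter.atTop
        (nhds (inner A x (S y))) :=
      ((CStarModule.continuous_inner (A := A) (E := E)).tendsto (x, S y)).comp
        (tendsto_const_nhds.prodMk_nhds (hSx y))
    simp_rw [inner_left] at h1
    exact tendsto_nhds_unique h1 h2
  have hmem : T ∈ adjointable A E := by
    refine ⟨fun a x => ext_inner (A := A) fun z => ?_, S, hadj⟩
    rw [← CStarModule.star_inner, hadj, CStarModule.inner_op_smul_left, ← hadj,
      CStarModule.inner_op_smul_right, star_mul, star_star, CStarModule.star_inner]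
  exact ⟨⟨T, hmem⟩, tendsto_subtype_rng.mpr hT⟩

instance [CompleteSpace E] : CStarAlgebra (Adj A E) where

end Adj

variable (A) in
/-- The rank-one operator `θ_{x,y}`, mapping `z` to `⟨y, z⟩ x` (`x ⟨y, z⟩` for right modules). -/
def rankOne (x y : E) : Adj A E :=
  let θ (x y : E) : E →L[ℂ] E :=
    LinearMap.mkContinuous
      { toFun := fun z => (inner A y z : A) • x
        map_add' := fun z w => by rw [CStarModule.inner_add_right, add_smul_alg]
        map_smul' := fun c z => by
          rw [CStarModule.inner_smul_right_complex, smul_smul_alg, RingHom.id_apply] }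
      (‖y‖ * ‖x‖) fun z => by
        refine (norm_smul_alg_le (inner A y z : A) x).trans ?_
        calc ‖(inner A y z : A)‖ * ‖x‖ ≤ (‖y‖ * ‖z‖) * ‖x‖ := by
              gcongr
              exact CStarModule.norm_inner_le E
          _ = ‖y‖ * ‖x‖ * ‖z‖ := by ring
  ⟨θ x y, fun a z => ext_inner (A := A) fun w => by
      change inner A w ((inner A y (a • z) : A) • x) = inner A w (a • (inner A y z : A) • x)
      simp [mul_assoc],
    θ y x, fun z w => by
      change inner A ((inner A y z : A) • x) w = inner A z ((inner A x w : A) • y)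
      simp⟩

variable (A E) in
/-- `𝓚(E)`, the compact operators: the closed linear span of the rank-one operators. -/
def compacts : Submodule ℂ (Adj A E) :=
  (Submodule.span ℂ {T | ∃ x y : E, T = rankOne A x y}).topologicalClosure

/-! ### Gradings and submodules -/

/-- A grading of the Hilbert module `E` over the graded C⋆-algebra `(A, α)`: a Banach space
decomposition `E = E₀ ⊕ E₁` with `E_n A_m ⊆ E_{n+m}` and `⟨E_n, E_m⟩ ⊆ A_{n+m}`. -/
structure Grading (α : CStarGrading A) (E : Type*) [NormedAddCommGroup E] [NormedSpace ℂ E]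
    [SMul A E] [CStarModule A E] where
  part : ZMod 2 → Submodule ℂ E
  isClosed_part : ∀ n, IsClosed (part n : Set E)
  isCompl_part : IsCompl (part 0) (part 1)
  smul_mem : ∀ {n m : ZMod 2} {a : A} {x : E}, x ∈ part n → a ∈ α.part m → a • x ∈ part (n + m)
  inner_mem : ∀ {n m : ZMod 2} {x y : E}, x ∈ part n → y ∈ part m →
    inner A x y ∈ α.part (n + m)

/-- The induced grading on `𝓛(E)`: `T` has degree `m` if `T E_n ⊆ E_{n+m}`. -/
def HasDegree {α : CStarGrading A} (𝒢 : Grading α E) (m : ZMod 2) (T : Adj A E) : Prop :=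
  ∀ n, ∀ x ∈ 𝒢.part n, T.1 x ∈ 𝒢.part (n + m)

/-- A `*`-homomorphism `C₀(ℝ) → 𝓛(E)` is graded if it preserves degrees. -/
def IsGradedHom {α : CStarGrading A} (𝒢 : Grading α E) (φ : C₀(ℝ, ℂ) →⋆ₙₐ[ℂ] Adj A E) : Prop :=
  ∀ n, ∀ f ∈ evenOddGrading.part n, HasDegree 𝒢 n (φ f)

variable (A E) in
/-- A closed `A`-submodule of `E`. -/
structure HilbertSubmodule extends Submodule ℂ E where
  smul_alg_mem : ∀ (a : A) {x : E}, x ∈ toSubmodule → a • x ∈ toSubmodule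
  isClosed : IsClosed (toSubmodule : Set E)

namespace HilbertSubmodule

variable (F : HilbertSubmodule A E)

instance : SMul A F.toSubmodule := ⟨fun a x => ⟨a • x.1, F.smul_alg_mem a x.2⟩⟩

/-- A closed submodule is a Hilbert module, with the restricted inner product. -/
instance : CStarModule A F.toSubmodule where
  inner x y := inner A x.1 y.1
  inner_add_right := CStarModule.inner_add_right
  inner_self_nonneg := CStarModule.inner_self_nonneg
  inner_self := CStarModule.inner_self.trans Submodule.coe_eq_zero
  inner_op_smul_right := CStarModule.inner_op_smul_right
  inner_smul_right_complex := CStarModule.inner_smul_right_complex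
  star_inner x y := CStarModule.star_inner x.1 y.1
  norm_eq_sqrt_norm_inner_self x := CStarModule.norm_eq_sqrt_norm_inner_self x.1

instance [CompleteSpace E] : CompleteSpace F.toSubmodule := F.isClosed.completeSpace_coe

/-- `F` is invariant under the `*`-homomorphism `φ`. -/
def IsInvariant (φ : C₀(ℝ, ℂ) →⋆ₙₐ[ℂ] Adj A E) : Prop :=
  ∀ f, ∀ x ∈ F.toSubmodule, (φ f).1 x ∈ F.toSubmodule

/-- `F` is graded: `F = (F ∩ E₀) + (F ∩ E₁)`. -/
def IsGraded {α : CStarGrading A} (𝒢 : Grading α E) : Prop :=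
  ∀ x ∈ F.toSubmodule, ∃ x₀ ∈ F.toSubmodule, ∃ x₁ ∈ F.toSubmodule,
    x₀ ∈ 𝒢.part 0 ∧ x₁ ∈ 𝒢.part 1 ∧ x₀ + x₁ = x

/-- The grading `F_n = F ∩ E_n` of a graded submodule. -/
def grading {α : CStarGrading A} (𝒢 : Grading α E) (hF : F.IsGraded 𝒢) :
    Grading α F.toSubmodule where
  part n := (𝒢.part n).comap F.toSubmodule.subtype
  isClosed_part n := (𝒢.isClosed_part n).preimage continuous_subtype_val
  isCompl_part := by
    refine ⟨?_, ?_⟩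
    · rw [Submodule.disjoint_def]
      exact fun x h0 h1 => Subtype.ext (Submodule.disjoint_def.mp 𝒢.isCompl_part.disjoint _ h0 h1)
    · rw [codisjoint_iff, Submodule.eq_top_iff']
      intro x
      obtain ⟨x₀, h₀, x₁, h₁, hx₀, hx₁, h⟩ := hF x.1 x.2
      exact Submodule.mem_sup.mpr ⟨⟨x₀, h₀⟩, hx₀, ⟨x₁, h₁⟩, hx₁, Subtype.ext h⟩
  smul_mem hx ha := 𝒢.smul_mem hx ha
  inner_mem hx hy := 𝒢.inner_mem hx hy

/-- `F` is complemented: `E = F ⊕ F^⊥`. -/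
def IsComplemented : Prop :=
  ∀ x : E, ∃ y ∈ F.toSubmodule, ∃ z : E, (∀ w ∈ F.toSubmodule, inner A w z = 0) ∧ x = y + z

variable {F}

theorem IsComplemented.exists_proj (hF : F.IsComplemented) :
    ∃ P : E →L[ℂ] F.toSubmodule, ∀ (x : E) (w : F.toSubmodule),
      inner A w.1 (P x).1 = inner A w.1 x := by
  choose p hp q hq h using hF
  have key : ∀ (x : E) (w : F.toSubmodule), inner A w.1 (p x) = inner A w.1 x := fun x w => by
    conv_rhs => rw [h x]
    rw [CStarModule.inner_add_right, hq x w.1 w.2, add_zero]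
  refine ⟨LinearMap.mkContinuous
    { toFun := fun x => ⟨p x, hp x⟩
      map_add' := fun x y => ext_inner (A := A) fun w => ?_
      map_smul' := fun c x => ext_inner (A := A) fun w => ?_ } 1 fun x => ?_, key⟩
  · change inner A w.1 (p (x + y)) = inner A w.1 (p x + p y)
    simp [key]
  · change inner A w.1 (p (c • x)) = inner A w.1 (c • p x)
    simp [key]
  · rw [one_mul]
    change ‖p x‖ ≤ ‖x‖
    refine norm_le_of_inner (A := A) (norm_nonneg _) ?_
    rw [key x ⟨p x, hp x⟩, mul_comm]
    exact CStarModule.norm_inner_le E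

/-- The orthogonal projection of `E` onto a complemented submodule. -/
def IsComplemented.proj (hF : F.IsComplemented) : E →L[ℂ] F.toSubmodule :=
  hF.exists_proj.choose

theorem IsComplemented.inner_proj (hF : F.IsComplemented) (x : E) (w : F.toSubmodule) :
    inner A w (hF.proj x) = inner A w.1 x :=
  hF.exists_proj.choose_spec x w

/-- The inclusion `𝓛(F) ⊆ 𝓛(E)` for a complemented submodule `F`: `T` acts as `T` on `F` and as
`0` on `F^⊥`. -/
def IsComplemented.extend (hF : F.IsComplemented) (T : Adj A F.toSubmodule) : Adj A E :=
  ⟨F.toSubmodule.subtypeL.comp (T.1.comp hF.proj), by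
    have h : ∀ (S : Adj A F.toSubmodule) (x y : E),
        inner A (S.1 (hF.proj x)).1 y = inner A (S.1 (hF.proj x)) (hF.proj y) :=
      fun S x y => (hF.inner_proj y _).symm
    have hadj : ∀ x y : E, inner A (T.1 (hF.proj x)).1 y
        = inner A x ((star T).1 (hF.proj y)).1 := fun x y => by
      rw [h, Adj.inner_left, ← CStarModule.star_inner, ← h, CStarModule.star_inner]
    refine ⟨fun a x => ext_inner (A := A) fun z => ?_,
      F.toSubmodule.subtypeL.comp ((star T).1.comp hF.proj), hadj⟩
    change inner A z (T.1 (hF.proj (a • x))).1 = inner A z (a • (T.1 (hF.proj x)).1)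
    rw [← CStarModule.star_inner, hadj, CStarModule.inner_op_smul_left, ← hadj,
      CStarModule.inner_op_smul_right, star_mul, star_star, CStarModule.star_inner]⟩

end HilbertSubmodule

/-! ### Properties of `*`-homomorphisms into `𝓛(E)` -/

/-- A filter on `𝓛(E)` is Cauchy in the strict topology, which is given by the seminorms
`T ↦ ‖T x‖` and `T ↦ ‖T* x‖`, `x ∈ E`. -/
def StrictCauchy (l : Filter (Adj A E)) : Prop :=
  ∀ x : E, Cauchy (l.map fun T => T.1 x) ∧ Cauchy (l.map fun T => (star T).1 x)

/-- `φ` is strict: `(φ(u_i))` is strictly Cauchy for some approximate unit `(u_i)` of `C₀(ℝ)`. -/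
def IsStrict (φ : C₀(ℝ, ℂ) →⋆ₙₐ[ℂ] Adj A E) : Prop :=
  ∃ l : Filter C₀(ℝ, ℂ), l.IsApproximateUnit ∧ StrictCauchy (l.map φ)

/-- The closed linear span of `φ(C₀(ℝ)) E`. -/
def essentialSubspace (φ : C₀(ℝ, ℂ) →⋆ₙₐ[ℂ] Adj A E) : Submodule ℂ E :=
  (Submodule.span ℂ {y | ∃ f x, y = (φ f).1 x}).topologicalClosure

/-- `φ` is nondegenerate: the span of `φ(C₀(ℝ)) E` is dense in `E`. -/
def IsNondegenerate (φ : C₀(ℝ, ℂ) →⋆ₙₐ[ℂ] Adj A E) : Prop :=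
  Dense (Submodule.span ℂ {y | ∃ f x, y = (φ f).1 x} : Set E)

/-! ### Regular operators -/

variable (A) in
/-- The graph of the adjoint of `D`: pairs `(y, z)` with `⟨D x, y⟩ = ⟨x, z⟩` for all `x` in the
domain of `D`. -/
def adjointGraph (D : E →ₗ.[ℂ] E) : Submodule ℂ (E × E) where
  carrier := {p | ∀ x : D.domain, inner A (D x) p.1 = inner A x.1 p.2}
  add_mem' {p q} hp hq x := by
    simp only [Prod.fst_add, Prod.snd_add, CStarModule.inner_add_right, hp x, hq x]
  zero_mem' x := by simp
  smul_mem' c p hp x := by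
    simp only [Prod.smul_fst, Prod.smul_snd, CStarModule.inner_smul_right_complex, hp x]

variable (A) in
/-- Regular operators: densely defined closed `A`-linear maps `D` such that `D*` is densely
defined and `1 + D*D` has dense range. -/
structure IsRegular (D : E →ₗ.[ℂ] E) : Prop where
  dense_domain : Dense (D.domain : Set E)
  isClosed : D.IsClosed
  map_smul_alg : ∀ (a : A) (x : D.domain), ∃ h : a • x.1 ∈ D.domain, D ⟨a • x.1, h⟩ = a • D x
  dense_adjoint : Dense {y : E | ∃ z, (y, z) ∈ adjointGraph A D}
  dense_range : Dense {w : E | ∃ (x : D.domain) (z : E),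
    (D x, z) ∈ adjointGraph A D ∧ w = x.1 + z}

variable (A) in
/-- `D = D*`, as an equality of graphs. -/
def IsSelfAdjointOp (D : E →ₗ.[ℂ] E) : Prop :=
  adjointGraph A D = D.graph

/-- `D` has degree one: its domain is graded and `D` maps `Domain(D) ∩ E_n` into `E_{n+1}`. -/
def HasDegreeOne {α : CStarGrading A} (𝒢 : Grading α E) (D : E →ₗ.[ℂ] E) : Prop :=
  (∀ x ∈ D.domain, ∃ x₀ ∈ D.domain, ∃ x₁ ∈ D.domain,
    x₀ ∈ 𝒢.part 0 ∧ x₁ ∈ 𝒢.part 1 ∧ x₀ + x₁ = x) ∧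
  ∀ (n : ZMod 2) (x : D.domain), x.1 ∈ 𝒢.part n → D x ∈ 𝒢.part (n + 1)

/-- `R = (D - z)⁻¹`. -/
def IsResolvent (D : E →ₗ.[ℂ] E) (z : ℂ) (R : Adj A E) : Prop :=
  (∀ y : E, ∃ x : D.domain, x.1 = R.1 y ∧ D x - z • x.1 = y) ∧
  ∀ x : D.domain, R.1 (D x - z • x.1) = x.1

variable (A) in
/-- `D` has compact resolvents: `(D - z)⁻¹` exists and belongs to `𝓚(E)` for all nonreal `z`. -/
def HasCompactResolvents (D : E →ₗ.[ℂ] E) : Prop :=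
  ∀ z : ℂ, z.im ≠ 0 → ∃ R ∈ compacts A E, IsResolvent D z R

open Classical in
variable (A) in
/-- The resolvent `(D - z)⁻¹` (and `0` if it does not exist). -/
def resolventOp (D : E →ₗ.[ℂ] E) (z : ℂ) : Adj A E :=
  if h : ∃ R : Adj A E, IsResolvent D z R then h.choose else 0

variable (A) in
/-- The Cayley transform `(D - i)(D + i)⁻¹ = 1 - 2i (D + i)⁻¹`, a unitary if `D` is self-adjoint
and regular. -/
def cayley (D : E →ₗ.[ℂ] E) : Adj A E :=
  1 - (2 * Complex.I) • resolventOp A D (-Complex.I)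

variable (A) in
/-- The functional calculus `f(D) ∈ 𝓛(E)` of a self-adjoint regular operator, for `f ∈ C₀(ℝ)`.
The map `t ↦ (t - i)/(t + i)` identifies `ℝ` with the unit circle without `1`, with inverse
`w ↦ i(1 + w)/(1 - w)`. It transports `f` to a continuous function on the circle, with value `0`
at `1`, and this is applied to the Cayley transform of `D` by the continuous functional calculus
for normal elements of the C⋆-algebra `𝓛(E)`. -/
def functionalCalculus [CompleteSpace E] (D : E →ₗ.[ℂ] E) (f : C₀(ℝ, ℂ)) : Adj A E :=
  open Classical in
  cfc (fun w : ℂ => if w = 1 then 0 else f (Complex.I * (1 + w) / (1 - w)).re) (cayley A D)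

end HilbertMod

end

/-!
Let `R = φ((t + i)⁻¹)`. Every `f ∈ C₀(ℝ)` is `h((t + i)⁻¹)` for a function `h` which is continuous
on the closure of the range of `(t + i)⁻¹` and vanishes at `0`, so `φ(f) = h(R)`. Hence the closure
of the range of `R` is the essential submodule of `φ`. On that submodule, `R` is normal with dense
range and `R* = R + 2i R R*`, which is what makes `D = R⁻¹ - i` self-adjoint and regular; by
construction `f(D) = h(R) = φ(f)` and `(D - z)⁻¹ = φ((t - z)⁻¹)`. The grading operator of `E`
conjugates `R` to `φ((-t + i)⁻¹) = -R*`, hence `D` to `-D`. If the operators `φ(f)` are compact,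
then so are their restrictions to the essential submodule, which are limits of the compressions
`φ(u) φ(f) φ(v)` with `u`, `v` in an approximate unit.
-/

noncomputable section

namespace HilbertMod

open Complex Filter Topology
open scoped CStarAlgebra

/-! ### Resolvents of self-adjoint elements -/

/-- The algebraic relations satisfied by `(D + i)⁻¹` for a self-adjoint `D`. In a unital algebra
they say that `1 - 2ia`, the Cayley transform of `D`, is unitary. -/
structure IsSelfAdjointResolvent {B : Type*} [NonUnitalRing B] [StarRing B] [Module ℂ B] (a : B) :
    Prop where
  isStarNormal : IsStarNormal a
  star_eq : star a = a + (2 * I) • (a * star a)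

theorem IsSelfAdjointResolvent.map {B C : Type*} [NonUnitalRing B] [StarRing B] [Module ℂ B]
    [NonUnitalRing C] [StarRing C] [Module ℂ C] {a : B} (ha : IsSelfAdjointResolvent a)
    (ψ : B →⋆ₙₐ[ℂ] C) : IsSelfAdjointResolvent (ψ a) where
  isStarNormal := ha.isStarNormal.map ψ
  star_eq := by rw [← map_star, ← map_mul, ← map_smul, ← map_add, ← ha.star_eq]

theorem inv_im_eq_one_of_star_eq {w : ℂ} (hw : w ≠ 0)
    (h : star w = w + 2 * I * (w * star w)) : (w⁻¹).im = 1 := by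
  have hw' : star w ≠ 0 := star_ne_zero.mpr hw
  have h_inv : w⁻¹ - star w⁻¹ = 2 * I := by
    rw [star_inv₀]
    field_simp
    linear_combination h
  have h_im : (w⁻¹).im + (w⁻¹).im = 2 := by
    simpa only [star_def, sub_im, conj_im, sub_neg_eq_add, mul_im, I_re, I_im, re_ofNat, im_ofNat,
      mul_one, mul_zero, add_zero] using congrArg im h_inv
  linarith

theorem IsSelfAdjointResolvent.quasispectrum_subset {B : Type*} [NonUnitalCStarAlgebra B] {a : B}
    (ha : IsSelfAdjointResolvent a) : quasispectrum ℂ a ⊆ {w | w ≠ 0 → (w⁻¹).im = 1} := by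
  have := ha.isStarNormal
  have h_star : cfcₙ (fun w : ℂ => star w) a
      = cfcₙ (fun w : ℂ => w + (2 * I) • (w * star w)) a := by
    rw [cfcₙ_add .., cfcₙ_smul .., cfcₙ_mul .., cfcₙ_star .., cfcₙ_id' ..]
    exact ha.star_eq
  have h_eqOn := eqOn_of_cfcₙ_eq_cfcₙ h_star
  exact fun w hw hw0 => inv_im_eq_one_of_star_eq hw0 (h_eqOn hw)

theorem ofReal_sub_ne_zero {z : ℂ} (hz : z.im ≠ 0) (t : ℝ) : (t : ℂ) - z ≠ 0 := fun h =>
  hz (by rw [← sub_eq_zero.mp h, ofReal_im])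

/-- The function `t ↦ (t - z)⁻¹` in `C₀(ℝ)`, for nonreal `z`. -/
def resolventFun (z : ℂ) (hz : z.im ≠ 0) : C₀(ℝ, ℂ) where
  toFun t := ((t : ℂ) - z)⁻¹
  continuous_toFun := Continuous.inv₀ (by fun_prop) (ofReal_sub_ne_zero hz)
  zero_at_infty' := by
    refine tendsto_inv₀_cobounded.comp (tendsto_norm_atTop_iff_cobounded.mp ?_)
    refine tendsto_atTop_mono (f := fun t : ℝ => ‖t‖ - ‖z‖) (fun t => ?_)
      (tendsto_atTop_add_const_right _ _ (tendsto_norm_cocompact_atTop (E := ℝ)))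
    simpa using norm_sub_norm_le (t : ℂ) z

@[simp]
theorem resolventFun_apply (z : ℂ) (hz : z.im ≠ 0) (t : ℝ) :
    resolventFun z hz t = ((t : ℂ) - z)⁻¹ := rfl

theorem resolventFun_eq_add {z w : ℂ} (hz : z.im ≠ 0) (hw : w.im ≠ 0) :
    resolventFun z hz
      = resolventFun w hw + (z - w) • (resolventFun w hw * resolventFun z hz) := by
  ext t
  have hz' := ofReal_sub_ne_zero hz t
  have hw' := ofReal_sub_ne_zero hw t
  simp only [ZeroAtInftyContinuousMap.add_apply, ZeroAtInftyContinuousMap.smul_apply,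
    ZeroAtInftyContinuousMap.mul_apply, resolventFun_apply, smul_eq_mul]
  field_simp
  ring

theorem I_im_ne_zero : I.im ≠ 0 := by simp

theorem neg_I_im_ne_zero : (-I).im ≠ 0 := by simp

/-- The function `t ↦ (t + i)⁻¹` in `C₀(ℝ)`. -/
def resolventNegI : C₀(ℝ, ℂ) := resolventFun (-I) neg_I_im_ne_zero

theorem resolventNegI_apply (t : ℝ) : resolventNegI t = ((t : ℂ) + I)⁻¹ := by
  rw [resolventNegI, resolventFun_apply, sub_neg_eq_add]

theorem resolventFun_eq_resolventNegI_add {z : ℂ} (hz : z.im ≠ 0) :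
    resolventFun z hz = resolventNegI + (z + I) • (resolventNegI * resolventFun z hz) := by
  simpa only [resolventNegI, sub_neg_eq_add] using resolventFun_eq_add hz neg_I_im_ne_zero

theorem star_resolventNegI : star resolventNegI = resolventFun I I_im_ne_zero := by
  ext t
  rw [ZeroAtInftyContinuousMap.star_apply, resolventNegI_apply, resolventFun_apply, star_def,
    map_inv₀, map_add, conj_ofReal, conj_I, sub_eq_add_neg]

theorem isSelfAdjointResolvent_resolventNegI : IsSelfAdjointResolvent resolventNegI where
  isStarNormal := ⟨Commute.all _ _⟩
  star_eq := by
    rw [two_mul, star_resolventNegI]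
    exact resolventFun_eq_resolventNegI_add _

theorem evenOddGrading_aut_resolventNegI :
    evenOddGrading.aut resolventNegI = -star resolventNegI := by
  ext t
  change resolventNegI (-t) = -star resolventNegI t
  rw [star_resolventNegI, resolventNegI_apply, resolventFun_apply, ofReal_neg, ← inv_neg]
  congr 1
  ring

/-! ### The functional calculus of a self-adjoint resolvent -/

/-- The function `h` on `ℂ` with `h ((t + i)⁻¹) = f t` and `h 0 = 0`, so that `f(D) = h((D + i)⁻¹)`
for self-adjoint `D`. -/
def resolventSymbol (f : C₀(ℝ, ℂ)) (w : ℂ) : ℂ :=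
  open Classical in if w = 0 then 0 else f (w⁻¹).re

@[simp]
theorem resolventSymbol_zero (f : C₀(ℝ, ℂ)) : resolventSymbol f 0 = 0 := if_pos rfl

theorem resolventSymbol_of_ne_zero (f : C₀(ℝ, ℂ)) {w : ℂ} (hw : w ≠ 0) :
    resolventSymbol f w = f (w⁻¹).re := if_neg hw

theorem resolventSymbol_resolventNegI (f : C₀(ℝ, ℂ)) (t : ℝ) :
    resolventSymbol f (resolventNegI t) = f t := by
  have h_ne : (t : ℂ) + I ≠ 0 := by simpa using ofReal_sub_ne_zero neg_I_im_ne_zero t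
  rw [resolventNegI_apply, resolventSymbol_of_ne_zero f (inv_ne_zero h_ne), inv_inv]
  simp

theorem tendsto_inv_re_cocompact :
    Tendsto (fun w : ℂ => (w⁻¹).re) (𝓝[{w | w ≠ 0 → (w⁻¹).im = 1} \ {0}] 0) (cocompact ℝ) := by
  rw [← Metric.cobounded_eq_cocompact, ← tendsto_norm_atTop_iff_cobounded]
  have h_inv : Tendsto (fun w : ℂ => ‖w⁻¹‖ - 1) (𝓝[{w | w ≠ 0 → (w⁻¹).im = 1} \ {0}] 0) atTop :=
    tendsto_atTop_add_const_right _ _ (tendsto_norm_cobounded_atTop.comp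
      (tendsto_inv₀_nhdsNE_zero.mono_left (nhdsWithin_mono _ fun w hw => hw.2)))
  refine tendsto_atTop_mono' _ ?_ h_inv
  filter_upwards [self_mem_nhdsWithin] with w ⟨hw, hw0⟩
  have := norm_le_abs_re_add_abs_im w⁻¹
  rw [hw hw0, abs_one] at this
  exact sub_le_iff_le_add.mpr this

theorem continuousOn_resolventSymbol (f : C₀(ℝ, ℂ)) :
    ContinuousOn (resolventSymbol f) {w | w ≠ 0 → (w⁻¹).im = 1} := by
  intro w _
  rcases eq_or_ne w 0 with rfl | hw
  · rw [← continuousWithinAt_sdiff_self, ContinuousWithinAt, resolventSymbol_zero]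
    refine (f.zero_at_infty'.comp tendsto_inv_re_cocompact).congr' ?_
    filter_upwards [self_mem_nhdsWithin] with w hw
    exact (resolventSymbol_of_ne_zero f hw.2).symm
  · have h_cont : ContinuousAt (fun w : ℂ => f (w⁻¹).re) w :=
      f.continuous.continuousAt.comp
        (continuous_re.continuousAt.comp (continuousAt_inv₀ hw))
    refine (h_cont.congr ?_).continuousWithinAt
    filter_upwards [isOpen_ne.mem_nhds hw] with v hv
    exact (resolventSymbol_of_ne_zero f hv).symm

theorem cfcₙ_apply_zeroAtInfty {X : Type*} [TopologicalSpace X] (g : C₀(X, ℂ)) {h : ℂ → ℂ}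
    (hh : ContinuousOn h (quasispectrum ℂ g)) (h0 : h 0 = 0) (x : X) :
    cfcₙ h g x = h (g x) := by
  let ev : C₀(X, ℂ) →⋆ₙₐ[ℂ] ℂ :=
    { toFun := fun g => g x
      map_smul' := fun _ _ => rfl
      map_zero' := rfl
      map_add' := fun _ _ => rfl
      map_mul' := fun _ _ => rfl
      map_star' := fun _ => rfl }
  have : IsStarNormal g := ⟨Commute.all _ _⟩
  have h_spec : quasispectrum ℂ (ev g) ⊆ quasispectrum ℂ g :=
    NonUnitalAlgHom.quasispectrum_apply_subset ev g
  calc cfcₙ h g x = cfcₙ h (ev g) := ev.map_cfcₙ h g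
    _ = h (g x) := by
      rw [cfcₙ_eq_cfc (hh.mono h_spec) h0]
      exact cfc_algebraMap (g x) h

theorem cfcₙ_resolventSymbol_resolventNegI (f : C₀(ℝ, ℂ)) :
    cfcₙ (resolventSymbol f) resolventNegI = f := by
  ext t
  rw [cfcₙ_apply_zeroAtInfty _ ((continuousOn_resolventSymbol f).mono
    isSelfAdjointResolvent_resolventNegI.quasispectrum_subset) (resolventSymbol_zero f),
    resolventSymbol_resolventNegI]

theorem map_eq_cfcₙ_resolventSymbol {B : Type*} [NonUnitalCStarAlgebra B]
    (ψ : C₀(ℝ, ℂ) →⋆ₙₐ[ℂ] B) (f : C₀(ℝ, ℂ)) :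
    ψ f = cfcₙ (resolventSymbol f) (ψ resolventNegI) := by
  have h_cont := (continuousOn_resolventSymbol f).mono
    isSelfAdjointResolvent_resolventNegI.quasispectrum_subset
  have := isSelfAdjointResolvent_resolventNegI.isStarNormal
  have := (isSelfAdjointResolvent_resolventNegI.map ψ).isStarNormal
  conv_lhs => rw [← cfcₙ_resolventSymbol_resolventNegI f]
  exact ψ.map_cfcₙ _ _

theorem circle_eq_resolventSymbol (f : C₀(ℝ, ℂ)) (v : ℂ) :
    (open Classical in if v = 1 then 0 else f (I * (1 + v) / (1 - v)).re)
      = resolventSymbol f ((2 * I)⁻¹ * (1 - v)) := by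
  rcases eq_or_ne v 1 with rfl | hv
  · simp
  have hv' : 1 - v ≠ 0 := sub_ne_zero.mpr hv.symm
  have h_inv : ((2 * I)⁻¹ * (1 - v))⁻¹ = I * (1 + v) / (1 - v) + I := by
    rw [mul_inv, inv_inv]
    field_simp
    ring
  rw [if_neg hv, resolventSymbol_of_ne_zero f (by simp [hv']), h_inv, add_re, I_re, add_zero]

theorem IsSelfAdjointResolvent.cfc_cayley {B : Type*} [CStarAlgebra B] {a : B}
    (ha : IsSelfAdjointResolvent a) (f : C₀(ℝ, ℂ)) :
    cfc (fun v : ℂ => open Classical in if v = 1 then 0 else f (I * (1 + v) / (1 - v)).re)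
      (1 - (2 * I) • a) = cfcₙ (resolventSymbol f) a := by
  have := ha.isStarNormal
  have h_cont := (continuousOn_resolventSymbol f).mono ha.quasispectrum_subset
  set u := 1 - (2 * I) • a with hu
  have := IsStarNormal.smul (2 * I) a
  have : IsStarNormal u := IsStarNormal.one_sub
  have h_symm : cfc (fun v : ℂ => (2 * I)⁻¹ * (1 - v)) u = a := by
    rw [cfc_const_mul .., cfc_sub .., cfc_const_one .., cfc_id' .., hu, sub_sub_cancel,
      inv_smul_smul₀ (by simp)]
  have h_spec : (fun v : ℂ => (2 * I)⁻¹ * (1 - v)) '' spectrum ℂ u = spectrum ℂ a := by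
    rw [← cfc_map_spectrum .., h_symm]
  simp only [circle_eq_resolventSymbol]
  rw [cfc_comp' _ _ u (h_spec ▸ h_cont.mono (spectrum_subset_quasispectrum ℂ a)), h_symm,
    cfcₙ_eq_cfc h_cont (resolventSymbol_zero f)]

section

variable {A E : Type*} [NonUnitalCStarAlgebra A] [PartialOrder A] [StarOrderedRing A]
  [NormedAddCommGroup E] [NormedSpace ℂ E] [SMul A E] [CStarModule A E]

/-! ### Adjointable operators -/

theorem smul_comm_alg (c : ℂ) (a : A) (x : E) : c • a • x = a • c • x :=
  ext_inner (A := A) fun z => by simp only [CStarModule.inner_smul_right_complex,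
    CStarModule.inner_op_smul_right, mul_smul_comm]

theorem continuous_smul_alg (a : A) : Continuous fun x : E => a • x :=
  AddMonoidHomClass.continuous_of_bound
    (AddMonoidHom.mk' (fun x : E => a • x) (smul_add_alg a)) ‖a‖ (norm_smul_alg_le a)

theorem continuous_inner_left (y : E) : Continuous fun x : E => inner A x y :=
  CStarModule.continuous_inner.comp (Continuous.prodMk_left y)

namespace Adj

theorem map_smul_alg (T : Adj A E) (a : A) (x : E) : T.1 (a • x) = a • T.1 x := T.2.1 a x

theorem ext {T S : Adj A E} (h : ∀ x, T.1 x = S.1 x) : T = S :=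
  Subtype.ext (ContinuousLinearMap.ext h)

theorem congr_apply {T S : Adj A E} (h : T = S) (x : E) : T.1 x = S.1 x := h ▸ rfl

theorem continuous_apply (x : E) : Continuous fun T : Adj A E => T.1 x :=
  (ContinuousLinearMap.apply ℂ E x).continuous.comp continuous_subtype_val

variable (A) in
/-- The operators `T` such that `T` and `T*` map `E` into `K`. -/
def withRangeIn (K : Submodule ℂ E) : NonUnitalStarSubalgebra ℂ (Adj A E) where
  carrier := {T | ∀ x, T.1 x ∈ K ∧ (star T).1 x ∈ K}
  add_mem' hT hS x := by
    rw [star_add]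
    exact ⟨add_mem (hT x).1 (hS x).1, add_mem (hT x).2 (hS x).2⟩
  zero_mem' x := by
    rw [star_zero]
    exact ⟨zero_mem K, zero_mem K⟩
  mul_mem' hT hS x := by
    rw [star_mul]
    exact ⟨(hT _).1, (hS _).2⟩
  smul_mem' c T hT x := by
    rw [star_smul]
    exact ⟨K.smul_mem c (hT x).1, K.smul_mem _ (hT x).2⟩
  star_mem' hT x := by
    rw [star_star]
    exact (hT x).symm

theorem isClosed_withRangeIn {K : Submodule ℂ E} (hK : IsClosed (K : Set E)) :
    IsClosed (withRangeIn A K : Set (Adj A E)) := by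
  have h_eq : (withRangeIn A K : Set (Adj A E))
      = ⋂ x, {T | T.1 x ∈ K} ∩ {T | (star T).1 x ∈ K} := by
    ext T
    simp only [Set.mem_iInter]
    rfl
  rw [h_eq]
  exact isClosed_iInter fun x => (hK.preimage (continuous_apply x)).inter
    (hK.preimage ((continuous_apply x).comp
      (starₗᵢ ℂ : Adj A E ≃ₗᵢ⋆[ℂ] Adj A E).continuous))

end Adj

/-! ### The operator with a given resolvent -/

/-- The graph of `R⁻¹ - i`. -/
def resolventGraph (R : Adj A E) : Submodule ℂ (E × E) where
  carrier := {p | R.1 (p.2 + I • p.1) = p.1}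
  add_mem' {p q} hp hq := by
    simp only [Set.mem_ofPred_eq, Prod.fst_add, Prod.snd_add] at *
    rw [smul_add, add_add_add_comm, map_add, hp, hq]
  zero_mem' := by simp
  smul_mem' c p hp := by
    simp only [Set.mem_ofPred_eq, Prod.smul_fst, Prod.smul_snd] at *
    rw [smul_comm I c, ← smul_add, map_smul, hp]

theorem mem_resolventGraph {R : Adj A E} {x v : E} :
    (x, v) ∈ resolventGraph R ↔ R.1 (v + I • x) = x := Iff.rfl

theorem isClosed_resolventGraph (R : Adj A E) : IsClosed (resolventGraph R : Set (E × E)) :=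
  isClosed_eq (f := fun p : E × E => R.1 (p.2 + I • p.1)) (by fun_prop) continuous_fst

/-- The operator `R⁻¹ - i`, whose resolvent at `-i` is `R`. It is meaningful for injective `R`. -/
def ofResolvent (R : Adj A E) : E →ₗ.[ℂ] E := (resolventGraph R).toLinearPMap

namespace IsSelfAdjointResolvent

variable {R : Adj A E} (hR : IsSelfAdjointResolvent R)
include hR

theorem star_apply (x : E) : (star R).1 x = R.1 x + (2 * I) • R.1 ((star R).1 x) :=
  Adj.congr_apply hR.star_eq x

theorem comm_apply (x : E) : (star R).1 (R.1 x) = R.1 ((star R).1 x) :=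
  Adj.congr_apply hR.isStarNormal.star_comm_self x

theorem star_apply_mem_range (x : E) : (star R).1 x ∈ R.1.range := by
  rw [hR.star_apply, ← map_smul, ← map_add]
  exact ⟨_, rfl⟩

theorem mem_resolventGraph_iff_star {x v : E} :
    (x, v) ∈ resolventGraph R ↔ (star R).1 (v - I • x) = x := by
  rw [mem_resolventGraph]
  constructor <;> intro h
  · have h_star := hR.star_apply (v + I • x)
    rw [← hR.comm_apply, h] at h_star
    have h_sub : v - I • x = v + I • x - (2 * I) • x := by module
    rw [h_sub, map_sub, map_smul, h_star, add_sub_cancel_right]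
  · have h_star := hR.star_apply (v - I • x)
    rw [h] at h_star
    have h_add : v + I • x = v - I • x + (2 * I) • x := by module
    rw [h_add, map_add, map_smul, ← h_star]

variable (hd : DenseRange R.1)
include hd

theorem eq_zero_of_apply {x : E} (hx : R.1 x = 0) : x = 0 := by
  have h_star : (star R).1 x = 0 := by
    rw [hR.star_apply, ← hR.comm_apply, hx, map_zero, smul_zero, add_zero]
  have h_inner : (fun w => inner A w x) = fun _ => 0 := by
    refine hd.equalizer (continuous_inner_left x) continuous_const (funext fun w => ?_)
    rw [Function.comp_apply, Adj.inner_left, h_star, CStarModule.inner_zero_right,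
      Function.comp_apply]
  exact CStarModule.inner_self.mp (congrFun h_inner x)

theorem graph_ofResolvent : (ofResolvent R).graph = resolventGraph R := by
  refine Submodule.toLinearPMap_graph_eq _ ?_
  rintro ⟨x, v⟩ hx (rfl : x = 0)
  rw [mem_resolventGraph, smul_zero, add_zero] at hx
  exact hR.eq_zero_of_apply hd hx

theorem apply_add_smul (x : (ofResolvent R).domain) : R.1 (ofResolvent R x + I • x.1) = x.1 := by
  rw [← mem_resolventGraph, ← hR.graph_ofResolvent hd]
  exact LinearPMap.mem_graph _ x

theorem exists_ofResolvent_eq {x v : E} (h : (x, v) ∈ resolventGraph R) :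
    ∃ hx : x ∈ (ofResolvent R).domain, ofResolvent R ⟨x, hx⟩ = v := by
  rw [← hR.graph_ofResolvent hd, LinearPMap.mem_graph_iff] at h
  obtain ⟨y, rfl, hy⟩ := h
  exact ⟨y.2, hy⟩

theorem exists_ofResolvent_apply_eq (w : E) :
    ∃ hx : R.1 w ∈ (ofResolvent R).domain, ofResolvent R ⟨R.1 w, hx⟩ = w - I • R.1 w :=
  hR.exists_ofResolvent_eq hd (by rw [mem_resolventGraph, sub_add_cancel])

theorem dense_domain : Dense ((ofResolvent R).domain : Set E) := by
  refine hd.mono ?_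
  rintro _ ⟨w, rfl⟩
  exact (hR.exists_ofResolvent_apply_eq hd w).1

theorem mem_adjointGraph_iff_star {y z : E} :
    (y, z) ∈ adjointGraph A (ofResolvent R) ↔ (star R).1 (z - I • y) = y := by
  have h_inner (w : E) : inner A w y - inner A w ((star R).1 (z - I • y))
      = inner A (w - I • R.1 w) y - inner A (R.1 w) z := by
    rw [← Adj.inner_left, CStarModule.inner_sub_right, CStarModule.inner_sub_left,
      CStarModule.inner_smul_left_complex, CStarModule.inner_smul_right_complex, star_def, conj_I]
    module
  constructor
  · intro h
    refine (ext_inner (A := A) fun w => ?_).symm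
    obtain ⟨hx, hD⟩ := hR.exists_ofResolvent_apply_eq hd w
    rw [← sub_eq_zero, h_inner, sub_eq_zero, ← hD]
    exact h ⟨R.1 w, hx⟩
  · intro h x
    have hx := hR.apply_add_smul hd x
    have h_eq := h_inner (ofResolvent R x + I • x.1)
    rw [h, sub_self, hx, add_sub_cancel_right] at h_eq
    exact sub_eq_zero.mp h_eq.symm

theorem adjointGraph_ofResolvent : adjointGraph A (ofResolvent R) = resolventGraph R := by
  ext ⟨y, z⟩
  rw [hR.mem_adjointGraph_iff_star hd, hR.mem_resolventGraph_iff_star]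

theorem isSelfAdjointOp : IsSelfAdjointOp A (ofResolvent R) :=
  (hR.adjointGraph_ofResolvent hd).trans (hR.graph_ofResolvent hd).symm

theorem map_smul_alg (a : A) (x : (ofResolvent R).domain) :
    ∃ h : a • x.1 ∈ (ofResolvent R).domain, ofResolvent R ⟨a • x.1, h⟩ = a • ofResolvent R x :=
  hR.exists_ofResolvent_eq hd (by
    rw [mem_resolventGraph, smul_comm_alg, ← smul_add_alg, R.map_smul_alg, hR.apply_add_smul hd])

/-- `w = (1 + D²) R R* w`, since `(1 + D²)⁻¹ = (D + i)⁻¹ (D - i)⁻¹`. -/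
theorem exists_add_eq (w : E) : ∃ (x : (ofResolvent R).domain) (z : E),
    (ofResolvent R x, z) ∈ adjointGraph A (ofResolvent R) ∧ w = x.1 + z := by
  set v := (star R).1 w
  obtain ⟨hx, hD⟩ := hR.exists_ofResolvent_apply_eq hd v
  refine ⟨⟨R.1 v, hx⟩, w - R.1 v, ?_, (add_sub_cancel _ _).symm⟩
  have h_add : w - R.1 v + I • (v - I • R.1 v) = w + I • v := by
    rw [smul_sub, smul_smul, I_mul_I]
    module
  rw [hD, hR.adjointGraph_ofResolvent hd, mem_resolventGraph, h_add, map_add, map_smul]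
  linear_combination (norm := module) -(hR.star_apply w)

theorem isRegular : IsRegular A (ofResolvent R) where
  dense_domain := hR.dense_domain hd
  isClosed := by
    rw [LinearPMap.IsClosed, hR.graph_ofResolvent hd]
    exact isClosed_resolventGraph R
  map_smul_alg := hR.map_smul_alg hd
  dense_adjoint := by
    refine (hR.dense_domain hd).mono fun x hx => ⟨ofResolvent R ⟨x, hx⟩, ?_⟩
    rw [hR.isSelfAdjointOp hd]
    exact LinearPMap.mem_graph _ ⟨x, hx⟩
  dense_range := dense_univ.mono fun w _ => hR.exists_add_eq hd w

theorem isResolvent {Q : Adj A E} {z : ℂ} (hRQ : Q = R + (z + I) • (R * Q))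
    (hQR : Q = R + (z + I) • (Q * R)) : IsResolvent (ofResolvent R) z Q := by
  constructor
  · intro y
    obtain ⟨hx, hD⟩ := hR.exists_ofResolvent_eq hd (x := Q.1 y) (v := y + z • Q.1 y) (by
      rw [mem_resolventGraph, add_assoc, ← add_smul, map_add, map_smul]
      exact (Adj.congr_apply hRQ y).symm)
    exact ⟨⟨_, hx⟩, rfl, by rw [hD, add_sub_cancel_right]⟩
  · intro x
    have hx := hR.apply_add_smul hd x
    have h_sub : ofResolvent R x - z • x.1
        = ofResolvent R x + I • x.1 - (z + I) • x.1 := by module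
    have hQ : Q.1 (ofResolvent R x + I • x.1) = x.1 + (z + I) • Q.1 x.1 := by
      conv_rhs => rw [← hx]
      exact Adj.congr_apply hQR _
    rw [h_sub, map_sub, map_smul, hQ, add_sub_cancel_right]

end IsSelfAdjointResolvent

theorem IsResolvent.unique {D : E →ₗ.[ℂ] E} {z : ℂ} {Q Q' : Adj A E} (h : IsResolvent D z Q)
    (h' : IsResolvent D z Q') : Q = Q' :=
  Adj.ext fun y => by
    obtain ⟨x, -, rfl⟩ := h.1 y
    rw [h.2, h'.2]

theorem IsResolvent.resolventOp_eq {D : E →ₗ.[ℂ] E} {z : ℂ} {Q : Adj A E}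
    (h : IsResolvent D z Q) : resolventOp A D z = Q := by
  have h_ex : ∃ R : Adj A E, IsResolvent D z R := ⟨Q, h⟩
  rw [resolventOp, dif_pos h_ex]
  exact h_ex.choose_spec.unique h

theorem IsSelfAdjointResolvent.functionalCalculus_ofResolvent [CompleteSpace E] {R : Adj A E}
    (hR : IsSelfAdjointResolvent R) (hd : DenseRange R.1) (f : C₀(ℝ, ℂ)) :
    functionalCalculus A (ofResolvent R) f = cfcₙ (resolventSymbol f) R := by
  have h_res : IsResolvent (ofResolvent R) (-I) R := by
    refine hR.isResolvent hd ?_ ?_ <;> rw [neg_add_cancel, zero_smul, add_zero]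
  rw [functionalCalculus, cayley, h_res.resolventOp_eq, hR.cfc_cayley]

end

/-! ### Grading involutions -/

theorem neg_one_pow_val_add (n m : ZMod 2) :
    (-1 : ℂ) ^ (n + m).val = (-1) ^ n.val * (-1) ^ m.val := by
  rw [ZMod.val_add, ← neg_one_pow_eq_pow_mod_two, pow_add]

theorem CStarGrading.exists_add_eq {A : Type*} [NonUnitalCStarAlgebra A] (α : CStarGrading A)
    (a : A) :
    ∃ a₀ ∈ α.part 0, ∃ a₁ ∈ α.part 1, a₀ + a₁ = a := by
  refine ⟨(2⁻¹ : ℂ) • (a + α.aut a), ?_, (2⁻¹ : ℂ) • (a - α.aut a), ?_, by module⟩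
  · change α.aut _ = (-1 : ℂ) ^ 0 • _
    rw [map_smul, map_add, α.aut_aut]
    module
  · change α.aut _ = (-1 : ℂ) ^ 1 • _
    rw [map_smul, map_sub, α.aut_aut]
    module

namespace Grading

variable {A E : Type*} [NonUnitalCStarAlgebra A] [PartialOrder A] [NormedAddCommGroup E]
  [NormedSpace ℂ E] [SMul A E] [CStarModule A E] {α : CStarGrading A} (𝒢 : Grading α E)

theorem exists_part_add_eq (x : E) : ∃ x₀ ∈ 𝒢.part 0, ∃ x₁ ∈ 𝒢.part 1, x₀ + x₁ = x :=
  Submodule.mem_sup.mp (𝒢.isCompl_part.sup_eq_top ▸ Submodule.mem_top)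

variable [CompleteSpace E]

theorem isTopCompl_part : (𝒢.part 0).IsTopCompl (𝒢.part 1) :=
  Submodule.IsCompl.isTopCompl_of_isClosed 𝒢.isCompl_part (𝒢.isClosed_part 0) (𝒢.isClosed_part 1)

/-- The grading operator of `E`, equal to `1` on `E₀` and to `-1` on `E₁`. -/
def involution : E →L[ℂ] E :=
  (2 : ℂ) • (𝒢.part 0).projectionL (𝒢.part 1) 𝒢.isTopCompl_part - 1

theorem involution_apply (x : E) :
    𝒢.involution x = (2 : ℂ) • (𝒢.part 0).projectionL (𝒢.part 1) 𝒢.isTopCompl_part x - x := rfl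

theorem mem_part_iff {n : ZMod 2} {x : E} :
    x ∈ 𝒢.part n ↔ 𝒢.involution x = (-1 : ℂ) ^ n.val • x := by
  have h_cases : n = 0 ∨ n = 1 := by decide +revert
  rw [involution_apply]
  rcases h_cases with rfl | rfl
  · rw [← Submodule.projectionL_eq_self_iff 𝒢.isTopCompl_part]
    change _ ↔ _ = (-1 : ℂ) ^ 0 • x
    rw [pow_zero, one_smul, sub_eq_iff_eq_add, ← two_smul ℂ x,
      (smul_right_injective E (two_ne_zero' ℂ)).eq_iff]
  · rw [← Submodule.projectionL_apply_eq_zero_iff 𝒢.isTopCompl_part]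
    change _ ↔ _ = (-1 : ℂ) ^ 1 • x
    rw [pow_one, neg_one_smul, sub_eq_neg_self, smul_eq_zero_iff_right two_ne_zero]

theorem exists_mem_part_of_involution_mem {S : Submodule ℂ E}
    (hS : ∀ x ∈ S, 𝒢.involution x ∈ S) {x : E} (hx : x ∈ S) :
    ∃ x₀ ∈ S, ∃ x₁ ∈ S, x₀ ∈ 𝒢.part 0 ∧ x₁ ∈ 𝒢.part 1 ∧ x₀ + x₁ = x := by
  obtain ⟨x₀, h₀, x₁, h₁, rfl⟩ := 𝒢.exists_part_add_eq x
  have hγ := hS _ hx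
  rw [map_add, 𝒢.mem_part_iff.mp h₀, 𝒢.mem_part_iff.mp h₁] at hγ
  have h_sub : x₀ - x₁ ∈ S := by
    convert hγ using 1
    change x₀ - x₁ = (-1 : ℂ) ^ 0 • x₀ + (-1 : ℂ) ^ 1 • x₁
    module
  refine ⟨x₀, ?_, x₁, ?_, h₀, h₁, rfl⟩
  · convert S.smul_mem (2⁻¹ : ℂ) (add_mem hx h_sub) using 1
    module
  · convert S.smul_mem (2⁻¹ : ℂ) (sub_mem hx h_sub) using 1
    module

end Grading

section

variable {A E : Type*} [NonUnitalCStarAlgebra A] [PartialOrder A] [StarOrderedRing A]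
  [NormedAddCommGroup E] [NormedSpace ℂ E] [SMul A E] [CStarModule A E] [CompleteSpace E]
  {α : CStarGrading A} {𝒢 : Grading α E}

theorem HasDegree.involution_apply {m : ZMod 2} {T : Adj A E} (hT : HasDegree 𝒢 m T) (x : E) :
    𝒢.involution (T.1 x) = (-1 : ℂ) ^ m.val • T.1 (𝒢.involution x) := by
  have h_part {n : ZMod 2} {x : E} (hx : x ∈ 𝒢.part n) :
      𝒢.involution (T.1 x) = (-1 : ℂ) ^ m.val • T.1 (𝒢.involution x) := by
    rw [𝒢.mem_part_iff.mp (hT n x hx), 𝒢.mem_part_iff.mp hx, map_smul, smul_smul,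
      neg_one_pow_val_add, mul_comm]
  obtain ⟨x₀, h₀, x₁, h₁, rfl⟩ := 𝒢.exists_part_add_eq x
  simp only [map_add, smul_add, h_part h₀, h_part h₁]

theorem IsGradedHom.involution_apply {φ : C₀(ℝ, ℂ) →⋆ₙₐ[ℂ] Adj A E}
    (hφ : IsGradedHom 𝒢 φ) (f : C₀(ℝ, ℂ)) (x : E) :
    𝒢.involution ((φ f).1 x) = (φ (evenOddGrading.aut f)).1 (𝒢.involution x) := by
  have h_part {m : ZMod 2} {f : C₀(ℝ, ℂ)} (hf : f ∈ evenOddGrading.part m) :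
      𝒢.involution ((φ f).1 x) = (φ (evenOddGrading.aut f)).1 (𝒢.involution x) := by
    rw [(hφ m f hf).involution_apply, show evenOddGrading.aut f = _ from hf, map_smul]
    rfl
  have h_add (f g : C₀(ℝ, ℂ)) (y : E) : (φ (f + g)).1 y = (φ f).1 y + (φ g).1 y :=
    Adj.congr_apply (map_add φ f g) y
  obtain ⟨f₀, h₀, f₁, h₁, rfl⟩ := evenOddGrading.exists_add_eq f
  rw [h_add, map_add, map_add, h_add, h_part h₀, h_part h₁]

theorem IsSelfAdjointResolvent.hasDegreeOne {R : Adj A E} (hR : IsSelfAdjointResolvent R)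
    (hd : DenseRange R.1) (h : ∀ x, 𝒢.involution (R.1 x) = -(star R).1 (𝒢.involution x)) :
    HasDegreeOne 𝒢 (ofResolvent R) := by
  have h_graph {x v : E} (hxv : (x, v) ∈ resolventGraph R) :
      (𝒢.involution x, -𝒢.involution v) ∈ resolventGraph R := by
    rw [hR.mem_resolventGraph_iff_star]
    conv_rhs => rw [← mem_resolventGraph.mp hxv, h, ← map_neg, map_add, map_smul, neg_add']
  constructor
  · refine fun x hx => 𝒢.exists_mem_part_of_involution_mem (fun y hy => ?_) hx
    exact (hR.exists_ofResolvent_eq hd (h_graph (hR.apply_add_smul hd ⟨y, hy⟩))).1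
  · intro n x hx
    have h_mem : (x.1, ofResolvent R x) ∈ (ofResolvent R).graph := LinearPMap.mem_graph _ x
    have h_neg := h_graph (hR.graph_ofResolvent hd ▸ h_mem)
    rw [← hR.graph_ofResolvent hd, 𝒢.mem_part_iff.mp hx] at h_neg
    have h_eq := LinearPMap.mem_graph_snd_inj _ h_neg
      (Submodule.smul_mem _ ((-1 : ℂ) ^ n.val) h_mem) rfl
    rw [𝒢.mem_part_iff, neg_one_pow_val_add, neg_eq_iff_eq_neg.mp h_eq]
    change _ = ((-1 : ℂ) ^ n.val * (-1) ^ 1) • _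
    module

end

section

variable {A E : Type*} [NonUnitalCStarAlgebra A] [PartialOrder A] [StarOrderedRing A]
  [NormedAddCommGroup E] [NormedSpace ℂ E] [SMul A E] [CStarModule A E]
  {φ : C₀(ℝ, ℂ) →⋆ₙₐ[ℂ] Adj A E}

/-! ### Nondegenerate homomorphisms -/

variable (φ) in
/-- The operator `φ((t + i)⁻¹)⁻¹ - i`, which is self-adjoint and regular with functional calculus
`φ` for nondegenerate `φ`. -/
def generator : E →ₗ.[ℂ] E := ofResolvent (φ resolventNegI)

theorem isSelfAdjointResolvent_apply_resolventNegI :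
    IsSelfAdjointResolvent (φ resolventNegI) :=
  isSelfAdjointResolvent_resolventNegI.map φ

theorem apply_mem_closure_range [CompleteSpace E] (f : C₀(ℝ, ℂ)) (x : E) :
    (φ f).1 x ∈ (φ resolventNegI).1.range.topologicalClosure := by
  set R := φ resolventNegI
  set K := R.1.range.topologicalClosure
  have hR : R ∈ Adj.withRangeIn A K := fun y =>
    ⟨R.1.range.le_topologicalClosure ⟨y, rfl⟩, R.1.range.le_topologicalClosure
      (isSelfAdjointResolvent_apply_resolventNegI.star_apply_mem_range y)⟩
  have := Adj.isClosed_withRangeIn (A := A) R.1.range.isClosed_topologicalClosure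
  have hf : φ f ∈ Adj.withRangeIn A K := by
    rw [map_eq_cfcₙ_resolventSymbol φ f]
    exact cfcₙ_mem _ hR
  exact (hf x).1

namespace IsNondegenerate

variable [CompleteSpace E] (hφ : IsNondegenerate φ)
include hφ

theorem denseRange_apply_resolventNegI : DenseRange (φ resolventNegI).1 := by
  have h_span : Submodule.span ℂ {y | ∃ f x, y = (φ f).1 x}
      ≤ (φ resolventNegI).1.range.topologicalClosure := by
    rw [Submodule.span_le]
    rintro _ ⟨f, x, rfl⟩
    exact apply_mem_closure_range f x
  exact dense_closure.mp (hφ.mono h_span)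

theorem isRegular_generator : IsRegular A (generator φ) :=
  isSelfAdjointResolvent_apply_resolventNegI.isRegular hφ.denseRange_apply_resolventNegI

theorem isSelfAdjointOp_generator : IsSelfAdjointOp A (generator φ) :=
  isSelfAdjointResolvent_apply_resolventNegI.isSelfAdjointOp hφ.denseRange_apply_resolventNegI

theorem functionalCalculus_generator (f : C₀(ℝ, ℂ)) :
    functionalCalculus A (generator φ) f = φ f := by
  rw [generator, isSelfAdjointResolvent_apply_resolventNegI.functionalCalculus_ofResolvent
    hφ.denseRange_apply_resolventNegI, ← map_eq_cfcₙ_resolventSymbol]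

theorem isResolvent_generator {z : ℂ} (hz : z.im ≠ 0) :
    IsResolvent (generator φ) z (φ (resolventFun z hz)) := by
  refine isSelfAdjointResolvent_apply_resolventNegI.isResolvent
    hφ.denseRange_apply_resolventNegI ?_ ?_
  · rw [← map_mul, ← map_smul, ← map_add, ← resolventFun_eq_resolventNegI_add]
  · rw [← map_mul, ← map_smul, ← map_add, mul_comm, ← resolventFun_eq_resolventNegI_add]

theorem hasDegreeOne_generator {α : CStarGrading A} {𝒢 : Grading α E} (h𝒢 : IsGradedHom 𝒢 φ) :
    HasDegreeOne 𝒢 (generator φ) := by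
  refine isSelfAdjointResolvent_apply_resolventNegI.hasDegreeOne
    hφ.denseRange_apply_resolventNegI fun x => ?_
  rw [h𝒢.involution_apply, evenOddGrading_aut_resolventNegI, map_neg, map_star]
  rfl

theorem hasCompactResolvents_generator (hK : ∀ f, φ f ∈ compacts A E) :
    HasCompactResolvents A (generator φ) :=
  fun _ hz => ⟨_, hK _, hφ.isResolvent_generator hz⟩

end IsNondegenerate

/-! ### Restriction to a closed submodule -/

namespace HilbertSubmodule

variable (F : HilbertSubmodule A E)

/-- The restriction of an adjointable operator to a submodule that is invariant under it and its
adjoint. -/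
def restrict (T : Adj A E) (h : ∀ x ∈ F.toSubmodule, T.1 x ∈ F.toSubmodule)
    (h' : ∀ x ∈ F.toSubmodule, (star T).1 x ∈ F.toSubmodule) : Adj A F.toSubmodule :=
  ⟨(T.1.comp F.toSubmodule.subtypeL).codRestrict F.toSubmodule fun x => h _ x.2,
    fun a x => Subtype.ext (T.map_smul_alg a x.1),
    ((star T).1.comp F.toSubmodule.subtypeL).codRestrict F.toSubmodule fun x => h' _ x.2,
    fun x y => T.inner_left x.1 y.1⟩

variable {F}

theorem adj_ext {T S : Adj A F.toSubmodule} (h : ∀ x, (T.1 x).1 = (S.1 x).1) : T = S :=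
  Adj.ext fun x => Subtype.ext (h x)

/-- The `*`-homomorphism into `𝓛(F)` given by restriction to the invariant submodule `F`. -/
def IsInvariant.restrictHom (hF : F.IsInvariant φ) : C₀(ℝ, ℂ) →⋆ₙₐ[ℂ] Adj A F.toSubmodule where
  toFun f := F.restrict (φ f) (hF f) (by rw [← map_star]; exact hF _)
  map_smul' c f := adj_ext (Adj.congr_apply (map_smul φ c f) ·.1)
  map_zero' := adj_ext (Adj.congr_apply (map_zero φ) ·.1)
  map_add' f g := adj_ext (Adj.congr_apply (map_add φ f g) ·.1)
  map_mul' f g := adj_ext (Adj.congr_apply (map_mul φ f g) ·.1)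
  map_star' f := (Adj.star_unique _ _ fun x y => ((φ f).inner_left x.1 y.1).trans
    (congrArg (inner A x.1) (Adj.congr_apply (map_star φ f).symm y.1))).symm

section compression

variable (F) (P Q : Adj A E) (hP : ∀ x, P.1 x ∈ F.toSubmodule)
  (hQ : ∀ x, (star Q).1 x ∈ F.toSubmodule)

/-- The compression `T ↦ P T Q`, as a map from `𝓛(E)` to `𝓛(F)`. -/
def compression : Adj A E →L[ℂ] Adj A F.toSubmodule :=
  LinearMap.mkContinuous
    { toFun := fun T => F.restrict (P * T * Q) (fun _ _ => hP _) (fun x _ => by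
        rw [star_mul]
        exact hQ _)
      map_add' := fun T S => adj_ext fun x => P.1.map_add (T.1 (Q.1 x.1)) (S.1 (Q.1 x.1))
      map_smul' := fun c T => adj_ext fun x => P.1.map_smul c (T.1 (Q.1 x.1)) }
    (‖P‖ * ‖Q‖) fun T => by
      refine ContinuousLinearMap.opNorm_le_bound _ (by positivity) fun x => ?_
      refine ((P * T * Q).1.le_opNorm x.1).trans (mul_le_mul_of_nonneg_right ?_ (norm_nonneg _))
      calc ‖P * T * Q‖ ≤ ‖P‖ * ‖T‖ * ‖Q‖ := norm_mul₃_le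
        _ = ‖P‖ * ‖Q‖ * ‖T‖ := mul_right_comm _ _ _

theorem compression_rankOne (x y : E) : F.compression P Q hP hQ (rankOne A x y)
    = rankOne A (⟨P.1 x, hP x⟩ : F.toSubmodule) ⟨(star Q).1 y, hQ y⟩ := by
  refine adj_ext fun w => ?_
  change P.1 ((inner A y (Q.1 w.1) : A) • x) = (inner A ((star Q).1 y) w.1 : A) • P.1 x
  rw [P.map_smul_alg, Adj.inner_right]

theorem compression_mem_compacts {T : Adj A E} (hT : T ∈ compacts A E) :
    F.compression P Q hP hQ T ∈ compacts A F.toSubmodule := by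
  refine map_mem_closure (F.compression P Q hP hQ).continuous hT fun S hS => ?_
  refine Submodule.span_mono ?_ (Submodule.apply_mem_span_image_of_mem_span
    (F.compression P Q hP hQ).toLinearMap hS)
  rintro _ ⟨_, ⟨x, y, rfl⟩, rfl⟩
  exact ⟨_, _, F.compression_rankOne P Q hP hQ x y⟩

end compression

end HilbertSubmodule

/-! ### The essential submodule -/

theorem apply_mem_essentialSubspace (f : C₀(ℝ, ℂ)) (x : E) : (φ f).1 x ∈ essentialSubspace φ :=
  Submodule.le_topologicalClosure _ (Submodule.subset_span ⟨f, x, rfl⟩)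

theorem essentialSubspace_le {S : Submodule ℂ E} (hS : IsClosed (S : Set E))
    (h : ∀ f x, (φ f).1 x ∈ S) : essentialSubspace φ ≤ S := by
  refine Submodule.topologicalClosure_minimal _ (Submodule.span_le.mpr ?_) hS
  rintro _ ⟨f, x, rfl⟩
  exact h f x

theorem map_mem_essentialSubspace (T : E →L[ℂ] E)
    (h : ∀ f x, T ((φ f).1 x) ∈ essentialSubspace φ) {x : E} (hx : x ∈ essentialSubspace φ) :
    T x ∈ essentialSubspace φ :=
  essentialSubspace_le (S := (essentialSubspace φ).comap T.toLinearMap)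
    ((Submodule.isClosed_topologicalClosure _).preimage T.continuous) h hx

theorem inner_eq_zero_of_mem_essentialSubspace {w y : E} (hw : w ∈ essentialSubspace φ)
    (hy : ∀ f, (φ f).1 y = 0) : inner A w y = 0 := by
  refine essentialSubspace_le (S := (CStarModule.innerSL (A := A).flip y).ker)
    (ContinuousLinearMap.isClosed_ker _) (fun f x => ?_) hw
  change inner A ((φ f).1 x) y = 0
  rw [Adj.inner_left, ← map_star, hy, CStarModule.inner_zero_right]

theorem IsNondegenerate.essentialSubspace_eq_top (h : IsNondegenerate φ) :
    essentialSubspace φ = ⊤ :=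
  Submodule.dense_iff_topologicalClosure_eq_top.mp h

variable (φ) in
/-- The closed linear span of `φ(C₀(ℝ)) E`, as a closed `A`-submodule. -/
def essentialSubmodule : HilbertSubmodule A E where
  toSubmodule := essentialSubspace φ
  smul_alg_mem a _ hx := map_mem_essentialSubspace
    ⟨⟨⟨(a • ·), smul_add_alg a⟩, fun c x => (smul_comm_alg c a x).symm⟩, continuous_smul_alg a⟩
    (fun f x => by
      change a • (φ f).1 x ∈ _
      rw [← Adj.map_smul_alg]
      exact apply_mem_essentialSubspace f (a • x)) hx
  isClosed := Submodule.isClosed_topologicalClosure _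

theorem isInvariant_essentialSubmodule : (essentialSubmodule φ).IsInvariant φ :=
  fun f x _ => apply_mem_essentialSubspace f x

variable (φ) in
/-- The corestriction of `φ` to the essential submodule. -/
def essentialHom : C₀(ℝ, ℂ) →⋆ₙₐ[ℂ] Adj A (essentialSubmodule φ).toSubmodule :=
  isInvariant_essentialSubmodule.restrictHom

theorem coe_essentialHom_apply (f : C₀(ℝ, ℂ)) (x : (essentialSubmodule φ).toSubmodule) :
    ((essentialHom φ f).1 x).1 = (φ f).1 x.1 := rfl

theorem extend_essentialHom (hc : (essentialSubmodule φ).IsComplemented) (f : C₀(ℝ, ℂ)) :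
    hc.extend (essentialHom φ f) = φ f := by
  refine Adj.ext fun x => ext_inner (A := A) fun v => ?_
  change inner A v ((φ f).1 (hc.proj x).1) = inner A v ((φ f).1 x)
  rw [Adj.inner_right, Adj.inner_right, ← map_star]
  exact hc.inner_proj x ⟨_, apply_mem_essentialSubspace (star f) v⟩

theorem exists_isApproximateUnit (B : Type*) [NonUnitalCStarAlgebra B] :
    ∃ l : Filter B, l.IsApproximateUnit := by
  let := CStarAlgebra.spectralOrder B
  have := CStarAlgebra.spectralOrderedRing B
  exact ⟨_, (CStarAlgebra.increasingApproximateUnit B).toIsApproximateUnit⟩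

theorem mem_of_forall_mul_mul_mem {B : Type*} [NonUnitalCStarAlgebra B] {S : Set B}
    (hS : IsClosed S) {b : B} (h : ∀ a c, a * b * c ∈ S) : b ∈ S := by
  obtain ⟨l, hl⟩ := exists_isApproximateUnit B
  have := hl.neBot
  have h_left (a : B) : a * b ∈ S :=
    hS.mem_of_tendsto (hl.tendsto_mul_left (a * b)) (.of_forall (h a))
  exact hS.mem_of_tendsto (hl.tendsto_mul_right b) (.of_forall h_left)

section

variable [CompleteSpace E]

theorem continuous_hom_apply (x : E) : Continuous fun f => (φ f).1 x :=
  (Adj.continuous_apply x).comp (by fun_prop)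

theorem isNondegenerate_essentialHom : IsNondegenerate (essentialHom φ) := by
  set F := (essentialSubmodule φ).toSubmodule
  set S : Submodule ℂ F := Submodule.span ℂ {y | ∃ f x, y = (essentialHom φ f).1 x}
  have h_le : F ≤ (S.map F.subtype).topologicalClosure := by
    refine essentialSubspace_le (Submodule.isClosed_topologicalClosure _) fun f x => ?_
    obtain ⟨l, hl⟩ := exists_isApproximateUnit C₀(ℝ, ℂ)
    have := hl.neBot
    have h_tendsto : Tendsto (fun u => (φ (u * f)).1 x) l (𝓝 ((φ f).1 x)) :=
      ((continuous_hom_apply x).tendsto _).comp (hl.tendsto_mul_right f)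
    refine mem_closure_of_tendsto h_tendsto (.of_forall fun u => ?_)
    exact ⟨(essentialHom φ u).1 ⟨(φ f).1 x, apply_mem_essentialSubspace f x⟩,
      Submodule.subset_span ⟨u, _, rfl⟩, (Adj.congr_apply (map_mul φ u f) x).symm⟩
  exact fun x => closure_subtype.mpr (h_le x.2)

theorem essentialHom_mem_compacts (h : ∀ f, φ f ∈ compacts A E) (f : C₀(ℝ, ℂ)) :
    essentialHom φ f ∈ compacts A (essentialSubmodule φ).toSubmodule := by
  have h_closed : IsClosed {f | essentialHom φ f ∈ compacts A (essentialSubmodule φ).toSubmodule} :=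
    isClosed_closure.preimage (by fun_prop)
  refine mem_of_forall_mul_mul_mem h_closed fun a b => ?_
  have h_eq : essentialHom φ (a * f * b) = (essentialSubmodule φ).compression (φ a) (φ b)
      (apply_mem_essentialSubspace a)
      (map_star φ b ▸ apply_mem_essentialSubspace (star b)) (φ f) :=
    HilbertSubmodule.adj_ext fun x => by
      rw [coe_essentialHom_apply, map_mul, map_mul]
      rfl
  rw [Set.mem_ofPred_eq, h_eq]
  exact HilbertSubmodule.compression_mem_compacts _ _ _ _ _ (h f)

theorem isGraded_essentialSubmodule {α : CStarGrading A} {𝒢 : Grading α E}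
    (hφ : IsGradedHom 𝒢 φ) : (essentialSubmodule φ).IsGraded 𝒢 := fun _ hx =>
  𝒢.exists_mem_part_of_involution_mem (fun _ hy => map_mem_essentialSubspace 𝒢.involution
    (fun f x => hφ.involution_apply f x ▸ apply_mem_essentialSubspace _ _) hy) hx

theorem IsGradedHom.essentialHom {α : CStarGrading A} {𝒢 : Grading α E} (hφ : IsGradedHom 𝒢 φ) :
    IsGradedHom ((essentialSubmodule φ).grading 𝒢 (isGraded_essentialSubmodule hφ))
      (essentialHom φ) :=
  fun n f hf m x hx => hφ n f hf m x.1 hx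

/-- The projection of `x` to the essential submodule is the limit of `φ(u_i) x`. -/
theorem IsStrict.isComplemented (h : IsStrict φ) : (essentialSubmodule φ).IsComplemented := by
  obtain ⟨l, hl, hc⟩ := h
  have := hl.neBot
  intro x
  obtain ⟨p, hp⟩ : ∃ p, Tendsto (fun u => (φ u).1 x) l (𝓝 p) := CompleteSpace.complete (hc x).1
  have h_zero (f : C₀(ℝ, ℂ)) : (φ f).1 (x - p) = 0 := by
    have h_x : Tendsto (fun u => (φ (f * u)).1 x) l (𝓝 ((φ f).1 x)) :=
      ((continuous_hom_apply x).tendsto _).comp (hl.tendsto_mul_left f)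
    have h_p : Tendsto (fun u => (φ (f * u)).1 x) l (𝓝 ((φ f).1 p)) := by
      simp only [map_mul]
      exact ((φ f).1.continuous.tendsto p).comp hp
    rw [map_sub, sub_eq_zero, tendsto_nhds_unique h_x h_p]
  exact ⟨p, (essentialSubmodule φ).isClosed.mem_of_tendsto hp
      (.of_forall fun u => apply_mem_essentialSubspace u x), x - p,
    fun w hw => inner_eq_zero_of_mem_essentialSubspace hw h_zero, (add_sub_cancel _ _).symm⟩

end

end

end HilbertMod

end

open HilbertMod in
theorem theorem3p2_general {A E : Type*}
    [NonUnitalCStarAlgebra A] [PartialOrder A] [StarOrderedRing A]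
    [NormedAddCommGroup E] [NormedSpace ℂ E] [SMul A E] [CStarModule A E] [CompleteSpace E]
    (φ : C₀(ℝ, ℂ) →⋆ₙₐ[ℂ] Adj A E) :
    ∃ (F : HilbertSubmodule A E) (D : F.toSubmodule →ₗ.[ℂ] F.toSubmodule),
      F.toSubmodule = essentialSubspace φ ∧
      F.IsInvariant φ ∧
      IsRegular A D ∧ IsSelfAdjointOp A D ∧
      (∀ (α : CStarGrading A) (𝒢 : Grading α E), IsGradedHom 𝒢 φ →
        ∃ hF : F.IsGraded 𝒢, HasDegreeOne (F.grading 𝒢 hF) D) ∧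
      (∀ (f : C₀(ℝ, ℂ)) (x : F.toSubmodule),
        (φ f).1 x.1 = ((functionalCalculus A D f).1 x).1) ∧
      (IsStrict φ → ∃ hc : F.IsComplemented, ∀ f : C₀(ℝ, ℂ),
        φ f = hc.extend (functionalCalculus A D f)) ∧
      (IsNondegenerate φ → F.toSubmodule = ⊤) ∧
      ((∀ f : C₀(ℝ, ℂ), φ f ∈ compacts A E) → HasCompactResolvents A D) := by
  have hψ : IsNondegenerate (essentialHom φ) := isNondegenerate_essentialHom
  refine ⟨essentialSubmodule φ, generator (essentialHom φ), rfl, isInvariant_essentialSubmodule,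
    hψ.isRegular_generator, hψ.isSelfAdjointOp_generator,
    fun α 𝒢 hφ => ⟨isGraded_essentialSubmodule hφ, hψ.hasDegreeOne_generator hφ.essentialHom⟩,
    fun f x => ?_, fun h => ⟨h.isComplemented, fun f => ?_⟩,
    IsNondegenerate.essentialSubspace_eq_top,
    fun h => hψ.hasCompactResolvents_generator (essentialHom_mem_compacts h)⟩
  · rw [hψ.functionalCalculus_generator, coe_essentialHom_apply]
  · rw [hψ.functionalCalculus_generator, extend_essentialHom]

open HilbertMod in
theorem theorem3p2 {A E : Type*}
    [NonUnitalCStarAlgebra A] [PartialOrder A] [StarOrderedRing A] (α : CStarGrading A)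
    [NormedAddCommGroup E] [NormedSpace ℂ E] [SMul A E] [CStarModule A E] [CompleteSpace E]
    (𝒢 : Grading α E)
    (φ : C₀(ℝ, ℂ) →⋆ₙₐ[ℂ] Adj A E) (hφ : IsGradedHom 𝒢 φ) :
    ∃ (F : HilbertSubmodule A E) (hF : F.IsGraded 𝒢)
      (D : F.toSubmodule →ₗ.[ℂ] F.toSubmodule),
      F.toSubmodule = essentialSubspace φ ∧
      F.IsInvariant φ ∧
      IsRegular A D ∧ IsSelfAdjointOp A D ∧ HasDegreeOne (F.grading 𝒢 hF) D ∧
      (∀ (f : C₀(ℝ, ℂ)) (x : F.toSubmodule),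
        (φ f).1 x.1 = ((functionalCalculus A D f).1 x).1) ∧
      (IsStrict φ → ∃ hc : F.IsComplemented, ∀ f : C₀(ℝ, ℂ),
        φ f = hc.extend (functionalCalculus A D f)) ∧
      (IsNondegenerate φ → F.toSubmodule = ⊤) ∧
      ((∀ f : C₀(ℝ, ℂ), φ f ∈ compacts A E) → HasCompactResolvents A D) := by
  obtain ⟨F, D, hF, h_inv, h_reg, h_sa, h_gr, h⟩ := theorem3p2_general φ
  exact ⟨F, (h_gr α 𝒢 hφ).1, D, hF, h_inv, h_reg, h_sa, (h_gr α 𝒢 hφ).2, h⟩
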